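/- Let $(\overline M,\langle\,,\rangle)$ be a smooth $3$-dimensional Lorentzian manifold (signature $(-,+,+)$) with Levi-Civita connection $\overline\nabla$ and Ricci tensor $\overline{\mathrm{Ric}}$. Suppose that $\overline{\mathrm{Ric}}(Z,Z)\ge 0$ for every timelike vector $Z$, and let $\xi$ be a global parallel lightlike vector field on $\overline M$, i.e. a smooth vector field with $\xi\neq 0$ everywhere, $\langle\xi,\xi\rangle=0$ and $\overline\nabla\xi=0$. Let $S$ be a connected complete Riemannian surface and let $x:S\to\overline M$ be a smooth isometric immersion (so that $x$ is spacelike) which is maximal, i.e. whose mean curvature vanishes identically. Then there is exactly one smooth unit timelike normal vector field $N$ along $x$ (so $\langle N,N\rangle=-1$) such that the function $\eta=\langle N,\xi\rangle$ on $S$ is positive everywhere. If $A$ denotes the shape operator $A v=-\overline\nabla_v N$ associated with this $N$, then $$|\nabla\eta|^2=\tfrac12\,\mathrm{trace}(A^2)\,\eta^2\quad\text{on } S,$$ where $\nabla\eta$ is the gradient of $\eta$ on $S$; and $\eta$ is constant if and only if $S$ is totally geodesic, i.e. the second fundamental form of $x$ vanishes identically. -/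

import Mathlib

noncomputable section

/-! ### The Levi-Civita connection of a metric given in coordinates -/

namespace CoordMetric

variable {E : Type*} [NormedAddCommGroup E] [NormedSpace ℝ E] (G : E → E →L[ℝ] E →L[ℝ] ℝ)

/-- Christoffel symbols of the first kind of a metric `G` on coordinate space:
`Γ(u, v, w) = ½ (∂_u G(v, w) + ∂_v G(u, w) - ∂_w G(u, v))`, as a linear form in `w`. -/
def christoffelFirst (y u v : E) : E →L[ℝ] ℝ :=
  (1 / 2 : ℝ) • (fderiv ℝ G y u v + fderiv ℝ G y v u - ((fderiv ℝ G y).flip u).flip v)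

theorem christoffelFirst_apply (y u v w : E) :
    christoffelFirst G y u v w =
      (1 / 2 : ℝ) * (fderiv ℝ G y u v w + fderiv ℝ G y v u w - fderiv ℝ G y w u v) := by
  simp [christoffelFirst]

/-- Christoffel symbols (of the second kind): `Γ(u, v)` is obtained from the first kind by raising
the last index with the inverse of the metric, so that `G(Γ(u, v), w) = Γ(u, v, w)` wherever `G` is
nondegenerate. -/
def christoffel (y : E) : E →ₗ[ℝ] E →ₗ[ℝ] E :=
  LinearMap.mk₂ ℝ (fun u v ↦ (G y).inverse (christoffelFirst G y u v))
    (fun u u' v ↦ by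
      rw [← map_add]; congr 1; ext w; simp [christoffelFirst_apply]; ring)
    (fun c u v ↦ by
      rw [← map_smul]; congr 1; ext w; simp [christoffelFirst_apply]; ring)
    (fun u v v' ↦ by
      rw [← map_add]; congr 1; ext w; simp [christoffelFirst_apply]; ring)
    (fun c u v ↦ by
      rw [← map_smul]; congr 1; ext w; simp [christoffelFirst_apply]; ring)

/-- The curvature `R(u, v)w = ∇_u ∇_v w - ∇_v ∇_u w` for constant vector fields `u, v, w`:
`R(u, v)w = ∂_u Γ(v, w) - ∂_v Γ(u, w) + Γ(u, Γ(v, w)) - Γ(v, Γ(u, w))`. -/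
def curvature (y u v w : E) : E :=
  fderiv ℝ (fun y' ↦ christoffel G y' v w) y u - fderiv ℝ (fun y' ↦ christoffel G y' u w) y v +
    christoffel G y u (christoffel G y v w) - christoffel G y v (christoffel G y u w)

end CoordMetric

end

open Bundle Manifold
open scoped ContDiff

noncomputable section

/-- Euclidean coordinate space of dimension `n`. -/
abbrev Coord (n : ℕ) : Type := EuclideanSpace ℝ (Fin n)

/-- A smooth Lorentzian metric on an `n`-dimensional manifold: a smooth symmetric bilinear form
on the tangent bundle which on each tangent space has signature `(-, +, ..., +)`, that is, some
vector is timelike and the form is positive definite on its orthogonal complement. -/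
structure LorentzianMetric (n : ℕ) (M : Type*) [TopologicalSpace M] [ChartedSpace (Coord n) M]
    [IsManifold (𝓡 n) ∞ M] where
  /-- The scalar product on each tangent space. -/
  form (q : M) : TangentSpace (𝓡 n) q →L[ℝ] TangentSpace (𝓡 n) q →L[ℝ] ℝ
  symm (q : M) (v w : TangentSpace (𝓡 n) q) : form q v w = form q w v
  signature (q : M) : ∃ u : TangentSpace (𝓡 n) q, form q u u < 0 ∧
    ∀ v : TangentSpace (𝓡 n) q, form q u v = 0 → v ≠ 0 → 0 < form q v v
  contMDiff : ContMDiff (𝓡 n) ((𝓡 n).prod 𝓘(ℝ, Coord n →L[ℝ] Coord n →L[ℝ] ℝ)) ∞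
    (fun q ↦ TotalSpace.mk' (Coord n →L[ℝ] Coord n →L[ℝ] ℝ)
      (E := fun q : M ↦ TangentSpace (𝓡 n) q →L[ℝ] TangentSpace (𝓡 n) q →L[ℝ] ℝ) q (form q))

namespace LorentzianMetric

section Ambient

variable {n : ℕ} {M : Type*} [TopologicalSpace M] [ChartedSpace (Coord n) M]
  [IsManifold (𝓡 n) ∞ M] (g : LorentzianMetric n M)

/-- The matrix `(g_ij)` of the metric in the preferred chart at `q`, as a bilinear form on
coordinate space depending on the coordinates `y` of a point. -/
def coordForm (q : M) (y : Coord n) : Coord n →L[ℝ] Coord n →L[ℝ] ℝ :=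
  let z : M := (extChartAt (𝓡 n) q).symm y
  let e : Coord n →L[ℝ] TangentSpace (𝓡 n) z :=
    (trivializationAt (Coord n) (TangentSpace (𝓡 n) : M → Type _) q).symmL ℝ z
  e.precomp ℝ ∘L g.form z ∘L e

/-- The Ricci tensor `Ric(v, w) = trace (u ↦ R(u, v)w)` at `q`, computed in the preferred chart
at `q`, which is also the one through which the tangent space at `q` is identified with
coordinate space. -/
def ricci (q : M) (v w : TangentSpace (𝓡 n) q) : ℝ :=
  ∑ i : Fin n, (CoordMetric.curvature (g.coordForm q) (extChartAt (𝓡 n) q q)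
    (EuclideanSpace.single i (1 : ℝ)) v w) i

/-- The timelike convergence condition: `Ric(Z, Z) ≥ 0` for every timelike vector `Z`. -/
def TimelikeConvergence : Prop :=
  ∀ (q : M) (Z : TangentSpace (𝓡 n) q), g.form q Z Z < 0 → 0 ≤ g.ricci q Z Z

/-- The Levi-Civita covariant derivative `v ↦ ∇_v Y` at `p` of a vector field `Y` along a map
`x : S → M`, computed in the preferred chart at `x p`. -/
def covDerivAlong {m : ℕ} {S : Type*} [TopologicalSpace S] [ChartedSpace (Coord m) S]
    (x : S → M) (Y : (p : S) → TangentSpace (𝓡 n) (x p)) (p : S) :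
    TangentSpace (𝓡 m) p →ₗ[ℝ] TangentSpace (𝓡 n) (x p) :=
  let Ycoord : S → Coord n := fun p' ↦
    (trivializationAt (Coord n) (TangentSpace (𝓡 n) : M → Type _) (x p) ⟨x p', Y p'⟩).2
  let dY : TangentSpace (𝓡 m) p →L[ℝ] Coord n := mfderiv (𝓡 m) 𝓘(ℝ, Coord n) Ycoord p
  let dx : TangentSpace (𝓡 m) p →L[ℝ] Coord n := mfderiv (𝓡 m) (𝓡 n) x p
  dY.toLinearMap +
    (CoordMetric.christoffel (g.coordForm (x p)) (extChartAt (𝓡 n) (x p) (x p))).flip (Y p) ∘ₗ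
      dx.toLinearMap

/-- `ξ` is a (smooth) parallel lightlike vector field on `M`: it is nowhere zero, `g(ξ, ξ) = 0`
and `∇ξ = 0`. -/
structure IsParallelLightlike (ξ : (q : M) → TangentSpace (𝓡 n) q) : Prop where
  contMDiff : ContMDiff (𝓡 n) (𝓡 n).tangent ∞
    (fun q ↦ (⟨q, ξ q⟩ : TangentBundle (𝓡 n) M))
  ne_zero (q : M) : ξ q ≠ 0
  lightlike (q : M) : g.form q (ξ q) (ξ q) = 0
  parallel (q : M) : g.covDerivAlong (m := n) (fun q' : M ↦ q') ξ q = 0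

end Ambient

section Hypersurface

variable {n m : ℕ} {M : Type*} [TopologicalSpace M] [ChartedSpace (Coord n) M]
  [IsManifold (𝓡 n) ∞ M] (g : LorentzianMetric n M)
  {S : Type*} [TopologicalSpace S] [ChartedSpace (Coord m) S] [IsManifold (𝓡 m) ∞ S]
  [RiemannianBundle (fun p : S ↦ TangentSpace (𝓡 m) p)]

/-- `x` is a smooth isometric immersion of the Riemannian manifold `S` into `(M, g)`; its image is
thus spacelike. -/
structure IsIsometricImmersion (x : S → M) : Prop where
  contMDiff : ContMDiff (𝓡 m) (𝓡 n) ∞ x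
  isometric (p : S) (v w : TangentSpace (𝓡 m) p) :
    g.form (x p) (mfderiv (𝓡 m) (𝓡 n) x p v) (mfderiv (𝓡 m) (𝓡 n) x p w) = inner ℝ v w

/-- The vector of `T_p S` which represents a linear form through the Riemannian metric. -/
def sharp (p : S) (ℓ : TangentSpace (𝓡 m) p →L[ℝ] ℝ) : TangentSpace (𝓡 m) p :=
  haveI : FiniteDimensional ℝ (TangentSpace (𝓡 m) p) :=
    inferInstanceAs (FiniteDimensional ℝ (Coord m))
  haveI : CompleteSpace (TangentSpace (𝓡 m) p) := FiniteDimensional.complete ℝ _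
  (InnerProductSpace.toDual ℝ (TangentSpace (𝓡 m) p)).symm ℓ

/-- The gradient of a function on a Riemannian manifold. -/
def gradient (f : S → ℝ) (p : S) : TangentSpace (𝓡 m) p :=
  sharp p (mfderiv (𝓡 m) 𝓘(ℝ, ℝ) f p)

/-- The tangent part of a vector `z` of `M` at `x p`: the vector `t` of `T_p S` such that
`⟨t, w⟩ = g(z, dx w)` for all `w`. -/
def tangentPart (x : S → M) (p : S) :
    TangentSpace (𝓡 n) (x p) →ₗ[ℝ] TangentSpace (𝓡 m) p where
  toFun z := sharp p ((g.form (x p) z) ∘L mfderiv (𝓡 m) (𝓡 n) x p)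
  map_add' z z' := by
    simp [sharp, ContinuousLinearMap.add_comp]
  map_smul' c z := by
    simp [sharp, ContinuousLinearMap.smul_comp]

/-- The second fundamental form: the normal part of `∇_v (dx W)`, where `W` is the local vector
field on `S` extending `w` with constant components in the preferred chart at `p`. -/
def secondFundamentalForm (x : S → M) (p : S) (v w : TangentSpace (𝓡 m) p) :
    TangentSpace (𝓡 n) (x p) :=
  let W : (p' : S) → TangentSpace (𝓡 m) p' := fun p' ↦
    (trivializationAt (Coord m) (TangentSpace (𝓡 m) : S → Type _) p).symmL ℝ p' w
  let z : TangentSpace (𝓡 n) (x p) :=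
    g.covDerivAlong x (fun p' ↦ mfderiv (𝓡 m) (𝓡 n) x p' (W p')) p v
  z - mfderiv (𝓡 m) (𝓡 n) x p (g.tangentPart x p z)

/-- `x` is totally geodesic: its second fundamental form vanishes. -/
def IsTotallyGeodesic (x : S → M) : Prop :=
  ∀ (p : S) (v w : TangentSpace (𝓡 m) p), g.secondFundamentalForm x p v w = 0

/-- The mean curvature vector: the trace of the second fundamental form, divided by `m`. -/
def meanCurvatureVector (x : S → M) (p : S) : TangentSpace (𝓡 n) (x p) :=
  haveI : FiniteDimensional ℝ (TangentSpace (𝓡 m) p) :=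
    inferInstanceAs (FiniteDimensional ℝ (Coord m))
  (1 / m : ℝ) • ∑ i, g.secondFundamentalForm x p
    (stdOrthonormalBasis ℝ (TangentSpace (𝓡 m) p) i)
    (stdOrthonormalBasis ℝ (TangentSpace (𝓡 m) p) i)

/-- A spacelike isometric immersion is maximal if its mean curvature vanishes. -/
def IsMaximal (x : S → M) : Prop := ∀ p : S, g.meanCurvatureVector (m := m) x p = 0

/-- `N` is a smooth unit timelike normal vector field along `x`. -/
structure IsUnitNormal (x : S → M) (N : (p : S) → TangentSpace (𝓡 n) (x p)) : Prop where
  contMDiff : ContMDiff (𝓡 m) (𝓡 n).tangent ∞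
    (fun p ↦ (⟨x p, N p⟩ : TangentBundle (𝓡 n) M))
  unit (p : S) : g.form (x p) (N p) (N p) = -1
  normal (p : S) (v : TangentSpace (𝓡 m) p) :
    g.form (x p) (N p) (mfderiv (𝓡 m) (𝓡 n) x p v) = 0

/-- The shape operator `A v = -∇_v N` associated with the unit normal field `N`, as an endomorphism
of `T_p S`. -/
def shapeOperator (x : S → M) (N : (p : S) → TangentSpace (𝓡 n) (x p)) (p : S) :
    TangentSpace (𝓡 m) p →ₗ[ℝ] TangentSpace (𝓡 m) p :=
  -(g.tangentPart x p ∘ₗ g.covDerivAlong x N p)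

end Hypersurface

end LorentzianMetric

end

/-! Write `T` for the tangent part of `ξ` along `x`. As `N` is a unit timelike normal in codimension
one, `ξ = dx T - η N`, and `g(ξ, ξ) = 0` forces `|T|² = η²`. Differentiating `η = g(N, ξ)` with `∇ξ
= 0` gives `dη(v) = g(∇_v N, ξ) = -⟨A v, T⟩`, because `∇_v N` is tangent; since `A` is self-adjoint,
`∇η = -A T`. On a surface, maximality says `trace A = 0`, so Cayley-Hamilton gives `A² = ½ trace(A²)
id`. Hence `|∇η|² = ⟨A² T, T⟩ = ½ trace(A²) η²`. If `η` is constant, positivity of `η` gives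
`trace(A²) = 0`, so `|A v|² = 0` for all `v`; conversely `A = 0` gives `dη = 0`, and `S` is
connected. The normal itself is `N = (dx T - ξ) / |T|`, where `T` never vanishes because a lightlike
vector cannot be normal to a spacelike hypersurface. Since the connection is defined through
Christoffel symbols in charts, its two characteristic properties have to be derived for fields along
a map: metric compatibility (`mfderiv_form`) and symmetry (`covDerivAlong_pushforwardConst_comm`).
-/

noncomputable section

/-! ### Christoffel symbols: symmetry and metric compatibility -/

namespace CoordMetric

variable {E : Type*} [NormedAddCommGroup E] [NormedSpace ℝ E] {G : E → E →L[ℝ] E →L[ℝ] ℝ} {y : E}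

theorem apply_christoffel (hG : (G y).IsInvertible) (u v w : E) :
    G y (christoffel G y u v) w = christoffelFirst G y u v w := by
  simp [christoffel, hG.self_apply_inverse]

theorem fderiv_swap (hsymm : ∀ y u v, G y u v = G y v u) (hd : DifferentiableAt ℝ G y)
    (u v w : E) : fderiv ℝ G y u v w = fderiv ℝ G y u w v := by
  have h1 : ∀ a b : E, HasFDerivAt (fun z ↦ G z a b) (((fderiv ℝ G y).flip a).flip b) y := fun a b ↦
    ((hd.hasFDerivAt.clm_apply (hasFDerivAt_const a y)).clm_apply
      (hasFDerivAt_const b y)).congr_fderiv (by ext; simp)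
  have h2 := (h1 v w).unique ((h1 w v).congr_of_eventuallyEq (.of_forall fun z ↦ hsymm z v w))
  simpa using congr($h2 u)

theorem christoffel_comm (hsymm : ∀ y u v, G y u v = G y v u) (hd : DifferentiableAt ℝ G y)
    (u v : E) : christoffel G y u v = christoffel G y v u := by
  simp only [christoffel, LinearMap.mk₂_apply]
  congr 1
  ext w
  rw [christoffelFirst_apply, christoffelFirst_apply, fderiv_swap hsymm hd w u v]
  ring

/-- Metric compatibility in coordinates: in `Γ(u, v, w) + Γ(u, w, v)` the derivatives in the
directions `v` and `w` cancel by symmetry of `G`. -/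
theorem fderiv_eq_christoffel (hsymm : ∀ y u v, G y u v = G y v u) (hd : DifferentiableAt ℝ G y)
    (hG : (G y).IsInvertible) (u v w : E) :
    fderiv ℝ G y u v w = G y (christoffel G y u v) w + G y v (christoffel G y u w) := by
  rw [hsymm y v, apply_christoffel hG, apply_christoffel hG, christoffelFirst_apply,
    christoffelFirst_apply, fderiv_swap hsymm hd u w v]
  ring

end CoordMetric

/-! ### Criteria for smoothness and invertibility of linear maps -/

theorem ContMDiffAt.of_clm_apply {D H M : Type*} [NormedAddCommGroup D] [NormedSpace ℝ D]
    [TopologicalSpace H] {I : ModelWithCorners ℝ D H} [TopologicalSpace M] [ChartedSpace H M]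
    {E F : Type*} [NormedAddCommGroup E] [NormedSpace ℝ E] [FiniteDimensional ℝ E]
    [NormedAddCommGroup F] [NormedSpace ℝ F] {n : WithTop ℕ∞} {f : M → E →L[ℝ] F} {y : M}
    (h : ∀ v, ContMDiffAt I 𝓘(ℝ, F) n (fun z ↦ f z v) y) :
    ContMDiffAt I 𝓘(ℝ, E →L[ℝ] F) n f y := by
  let b := Module.finBasis ℝ E
  have key : f = fun z ↦ ∑ i, ((b.coord i).toContinuousLinearMap).smulRight (f z (b i)) := by
    funext z
    ext v
    conv_lhs => rw [← b.sum_repr v, map_sum]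
    simp
  rw [key]
  refine ContMDiffAt.sum fun i _ ↦ ?_
  exact ((ContinuousLinearMap.smulRightL ℝ E F
    (b.coord i).toContinuousLinearMap).contMDiff).contMDiffAt.comp y (h (b i))

theorem ContinuousLinearMap.isInvertible_of_injective_dual {E : Type*} [NormedAddCommGroup E]
    [NormedSpace ℝ E] [FiniteDimensional ℝ E] {B : E →L[ℝ] E →L[ℝ] ℝ}
    (hinj : Function.Injective B) : B.IsInvertible := by
  have hdim : Module.finrank ℝ E = Module.finrank ℝ (E →L[ℝ] ℝ) := by
    rw [← (LinearMap.toContinuousLinearMap (𝕜 := ℝ) (E := E) (F' := ℝ)).finrank_eq]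
    exact (Subspace.dual_finrank_eq (K := ℝ) (V := E)).symm
  exact ⟨(LinearEquiv.ofInjectiveOfFinrankEq
    B.toLinearMap hinj hdim).toContinuousLinearEquiv, by ext; rfl⟩

/-! ### The metric in a chart -/

namespace LorentzianMetric

variable {n : ℕ} {M : Type*} [TopologicalSpace M] [ChartedSpace (Coord n) M]
  [IsManifold (𝓡 n) ∞ M] (g : LorentzianMetric n M)

/-- Nondegeneracy: such a `v` is orthogonal to a timelike vector, so it would be spacelike if
nonzero, against `g(v, v) = 0`. -/
theorem eq_zero_of_form_eq_zero (q : M) (v : TangentSpace (𝓡 n) q) (h : ∀ w, g.form q v w = 0) :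
    v = 0 := by
  obtain ⟨u, hu, hpos⟩ := g.signature q
  have key : g.form q u v = 0 := by rw [g.symm, h]
  by_contra hv
  have := hpos v key hv
  rw [h] at this
  exact this.false

theorem coordForm_apply (q : M) (y u v : Coord n) :
    g.coordForm q y u v = g.form ((extChartAt (𝓡 n) q).symm y)
      ((trivializationAt (Coord n) (TangentSpace (𝓡 n) : M → Type _) q).symmL ℝ _ u)
      ((trivializationAt (Coord n) (TangentSpace (𝓡 n) : M → Type _) q).symmL ℝ _ v) := rfl

theorem coordForm_symm (q : M) (y u v : Coord n) :
    g.coordForm q y u v = g.coordForm q y v u := g.symm _ _ _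

theorem coordForm_trivialization {q z : M} (hz : z ∈ (chartAt (Coord n) q).source)
    (u v : TangentSpace (𝓡 n) z) :
    g.coordForm q (extChartAt (𝓡 n) q z)
      (trivializationAt (Coord n) (TangentSpace (𝓡 n) : M → Type _) q ⟨z, u⟩).2
      (trivializationAt (Coord n) (TangentSpace (𝓡 n) : M → Type _) q ⟨z, v⟩).2 =
      g.form z u v := by
  have hz' : z ∈ (trivializationAt (Coord n) (TangentSpace (𝓡 n) : M → Type _) q).baseSet := hz
  have hzz : (extChartAt (𝓡 n) q).symm (extChartAt (𝓡 n) q z) = z :=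
    (extChartAt (𝓡 n) q).left_inv (by simpa using hz)
  rw [coordForm_apply, hzz]
  have key : ∀ w : TangentSpace (𝓡 n) z,
      (trivializationAt (Coord n) (TangentSpace (𝓡 n) : M → Type _) q).symmL ℝ z
        (trivializationAt (Coord n) (TangentSpace (𝓡 n) : M → Type _) q ⟨z, w⟩).2 = w := by
    intro w
    have := Trivialization.symmL_continuousLinearMapAt
      (trivializationAt (Coord n) (TangentSpace (𝓡 n) : M → Type _) q)
      (R := ℝ) hz' w
    rwa [Trivialization.continuousLinearMapAt_apply, Trivialization.linearMapAt_apply, if_pos hz']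
      at this
  rw [key, key]

/-- At the centre of its own chart a tangent vector is its own component vector. This lets chart
formulas evaluated there be read as identities between tangent vectors. -/
theorem trivializationAt_self (q : M) (v : TangentSpace (𝓡 n) q) :
    (trivializationAt (Coord n) (TangentSpace (𝓡 n) : M → Type _) q ⟨q, v⟩).2 = v :=
  tangentCoordChange_self (I := 𝓡 n) (x := q) (z := q) (by simp)

theorem coordForm_self (q : M) (u v : TangentSpace (𝓡 n) q) :
    g.coordForm q (extChartAt (𝓡 n) q q) u v = g.form q u v := by
  have := g.coordForm_trivialization (mem_chart_source (Coord n) q) u v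
  rwa [trivializationAt_self, trivializationAt_self] at this

theorem isInvertible_coordForm (q : M) :
    (g.coordForm q (extChartAt (𝓡 n) q q)).IsInvertible := by
  refine ContinuousLinearMap.isInvertible_of_injective_dual
    ((injective_iff_map_eq_zero _).2 fun v hv ↦ ?_)
  refine g.eq_zero_of_form_eq_zero q v fun w ↦ ?_
  exact (g.coordForm_self q v w).symm.trans (by rw [hv]; rfl)

theorem contMDiffAt_form {m : ℕ} {S : Type*} [TopologicalSpace S] [ChartedSpace (Coord m) S]
    {x : S → M} {Y Z : (p : S) → TangentSpace (𝓡 n) (x p)} {p : S}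
    (hY : ContMDiffAt (𝓡 m) (𝓡 n).tangent ∞ (fun p ↦ (⟨x p, Y p⟩ : TangentBundle (𝓡 n) M)) p)
    (hZ : ContMDiffAt (𝓡 m) (𝓡 n).tangent ∞ (fun p ↦ (⟨x p, Z p⟩ : TangentBundle (𝓡 n) M)) p) :
    ContMDiffAt (𝓡 m) 𝓘(ℝ, ℝ) ∞ (fun p ↦ g.form (x p) (Y p) (Z p)) p := by
  have hx : ContMDiffAt (𝓡 m) (𝓡 n) ∞ x p := (contMDiffAt_totalSpace.1 hY).1
  have := ContMDiffAt.clm_bundle_apply₂ (E₃ := Bundle.Trivial M ℝ) (F₃ := ℝ)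
    ((g.contMDiff (x p)).comp p hx) hY hZ
  exact (contMDiffAt_totalSpace.1 this).2

theorem contMDiffAt_symmL {q z : M} (hz : z ∈ (chartAt (Coord n) q).source) (u : Coord n) :
    ContMDiffAt (𝓡 n) (𝓡 n).tangent ∞
      (fun z ↦ (⟨z, (trivializationAt (Coord n) (TangentSpace (𝓡 n) : M → Type _) q).symmL ℝ z u⟩ :
        TangentBundle (𝓡 n) M)) z := by
  rw [(trivializationAt (Coord n) (TangentSpace (𝓡 n) : M → Type _) q).contMDiffAt_iff hz]
  refine ⟨contMDiffAt_id, contMDiffAt_const (c := u) |>.congr_of_eventuallyEq ?_⟩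
  filter_upwards [(chartAt (Coord n) q).open_source.mem_nhds hz] with z' hz'
  rw [Trivialization.symmL_apply _ hz']
  exact congrArg Prod.snd
    ((trivializationAt (Coord n) (TangentSpace (𝓡 n) : M → Type _) q).apply_mk_symm hz' u)

theorem contDiffAt_coordForm (q : M) :
    ContDiffAt ℝ ∞ (g.coordForm q) (extChartAt (𝓡 n) q q) := by
  rw [← contMDiffAt_iff_contDiffAt]
  refine .of_clm_apply fun u ↦ .of_clm_apply fun v ↦ ?_
  have h1 := g.contMDiffAt_form (contMDiffAt_symmL (mem_chart_source (Coord n) q) u)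
    (contMDiffAt_symmL (mem_chart_source (Coord n) q) v)
  have h2 : ContMDiffAt 𝓘(ℝ, Coord n) (𝓡 n) ∞ (extChartAt (𝓡 n) q).symm (extChartAt (𝓡 n) q q) :=
    (contMDiffOn_extChartAt_symm q).contMDiffAt (extChartAt_target_mem_nhds q)
  exact h1.comp_of_eq h2 (by simp)

end LorentzianMetric

/-! ### Product rule for the metric along a map -/

set_option synthInstance.maxHeartbeats 200000 in
theorem CoordMetric.hasFDerivAt_apply {D E : Type*} [NormedAddCommGroup D] [NormedSpace ℝ D]
    [NormedAddCommGroup E] [NormedSpace ℝ E] {G : E → E →L[ℝ] E →L[ℝ] ℝ} {a b c : D → E} {t : D}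
    {a' b' c' : D →L[ℝ] E} (hsymm : ∀ y u v, G y u v = G y v u)
    (hd : DifferentiableAt ℝ G (a t)) (hG : (G (a t)).IsInvertible)
    (ha : HasFDerivAt a a' t) (hb : HasFDerivAt b b' t) (hc : HasFDerivAt c c' t) :
    ∃ L : D →L[ℝ] ℝ, HasFDerivAt (fun s ↦ G (a s) (b s) (c s)) L t ∧
      ∀ v, L v = G (a t) (b' v + christoffel G (a t) (a' v) (b t)) (c t) +
        G (a t) (b t) (c' v + christoffel G (a t) (a' v) (c t)) := by
  have h1 : HasFDerivAt (fun s ↦ G (a s)) ((fderiv ℝ G (a t)).comp a') t :=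
    HasFDerivAt.comp (F := E) (G := E →L[ℝ] E →L[ℝ] ℝ) (g := G) t hd.hasFDerivAt ha
  refine ⟨_, (h1.clm_apply hb).clm_apply hc, fun v ↦ ?_⟩
  have h2 := fderiv_eq_christoffel hsymm hd hG (a' v) (b t) (c t)
  simp [h2]
  ring

section
variable {m : ℕ} {S : Type*} [TopologicalSpace S] [ChartedSpace (Coord m) S]
  {F : Type*} [NormedAddCommGroup F] [NormedSpace ℝ F]

theorem HasMFDerivAt.hasFDerivAt_comp_extChartAt_symm {f : S → F} {p : S}
    {f' : TangentSpace (𝓡 m) p →L[ℝ] TangentSpace 𝓘(ℝ, F) (f p)}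
    (h : HasMFDerivAt (𝓡 m) 𝓘(ℝ, F) f p f') :
    HasFDerivAt (F := F) (E := Coord m) (f ∘ (extChartAt (𝓡 m) p).symm) f'
      (extChartAt (𝓡 m) p p) := by
  have := h.2
  simp only [mfld_simps] at this
  exact hasFDerivWithinAt_univ.1 this

theorem HasFDerivAt.hasMFDerivAt_of_comp_extChartAt_symm {f : S → F} {p : S}
    {f' : Coord m →L[ℝ] F} (hf : ContinuousAt f p)
    (h : HasFDerivAt (f ∘ (extChartAt (𝓡 m) p).symm) f' (extChartAt (𝓡 m) p p)) :
    HasMFDerivAt (𝓡 m) 𝓘(ℝ, F) f p f' := by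
  refine ⟨hf, ?_⟩
  simp only [mfld_simps]
  exact hasFDerivWithinAt_univ.2 h
end

namespace LorentzianMetric

variable {n m : ℕ} {M : Type*} [TopologicalSpace M] [ChartedSpace (Coord n) M]
  [IsManifold (𝓡 n) ∞ M] (g : LorentzianMetric n M)
  {S : Type*} [TopologicalSpace S] [ChartedSpace (Coord m) S]
  {x : S → M} {Y Z : (p : S) → TangentSpace (𝓡 n) (x p)} {p : S}

/-- The components, in the preferred chart at `x p`, of a vector field along `x`. -/
def coordAlong (x : S → M) (Y : (p : S) → TangentSpace (𝓡 n) (x p)) (p p' : S) : Coord n :=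
  (trivializationAt (Coord n) (TangentSpace (𝓡 n) : M → Type _) (x p) ⟨x p', Y p'⟩).2

/-- The derivative at `p` of the components of a vector field along `x`. -/
def coordAlongDeriv (x : S → M) (Y : (p : S) → TangentSpace (𝓡 n) (x p)) (p : S) :
    Coord m →L[ℝ] Coord n :=
  mfderiv (𝓡 m) 𝓘(ℝ, Coord n) (coordAlong x Y p) p

/-- The differential of `x` as a linear map of coordinate spaces. -/
def coordDeriv (m : ℕ) {S : Type*} [TopologicalSpace S] [ChartedSpace (Coord m) S]
    (x : S → M) (p : S) : Coord m →L[ℝ] Coord n :=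
  mfderiv (𝓡 m) (𝓡 n) x p

theorem coordAlong_self (x : S → M) (Y : (p : S) → TangentSpace (𝓡 n) (x p)) (p : S) :
    coordAlong x Y p p = Y p := trivializationAt_self _ _

theorem covDerivAlong_apply (x : S → M) (Y : (p : S) → TangentSpace (𝓡 n) (x p)) (p : S)
    (v : TangentSpace (𝓡 m) p) :
    g.covDerivAlong x Y p v = coordAlongDeriv x Y p v +
      CoordMetric.christoffel (g.coordForm (x p)) (extChartAt (𝓡 n) (x p) (x p))
        (coordDeriv m x p v) (Y p) := rfl

theorem hasFDerivAt_extChartAt_comp (hx : MDifferentiableAt (𝓡 m) (𝓡 n) x p) :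
    HasFDerivAt (fun s ↦ extChartAt (𝓡 n) (x p) (x ((extChartAt (𝓡 m) p).symm s)))
      (coordDeriv m x p) (extChartAt (𝓡 m) p p) := by
  have := hx.hasMFDerivAt.2
  simp only [mfld_simps] at this
  exact hasFDerivWithinAt_univ.1 this

theorem contMDiffAt_coordAlong
    (hY : ContMDiffAt (𝓡 m) (𝓡 n).tangent ∞ (fun p ↦ (⟨x p, Y p⟩ : TangentBundle (𝓡 n) M)) p) :
    ContMDiffAt (𝓡 m) 𝓘(ℝ, Coord n) ∞ (coordAlong x Y p) p :=
  (contMDiffAt_totalSpace.1 hY).2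

theorem hasFDerivAt_coordAlong
    (hY : ContMDiffAt (𝓡 m) (𝓡 n).tangent ∞ (fun p ↦ (⟨x p, Y p⟩ : TangentBundle (𝓡 n) M)) p) :
    HasFDerivAt (fun s ↦ coordAlong x Y p ((extChartAt (𝓡 m) p).symm s))
      (coordAlongDeriv x Y p) (extChartAt (𝓡 m) p p) :=
  ((contMDiffAt_coordAlong hY).mdifferentiableAt
    (by simp)).hasMFDerivAt.hasFDerivAt_comp_extChartAt_symm

theorem coordForm_coordAlong_eventuallyEq (hx : ContinuousAt x p) :
    (fun p ↦ g.form (x p) (Y p) (Z p)) =ᶠ[nhds p] fun p' ↦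
      g.coordForm (x p) (extChartAt (𝓡 n) (x p) (x p')) (coordAlong x Y p p')
        (coordAlong x Z p p') := by
  filter_upwards [hx.preimage_mem_nhds
    ((chartAt (Coord n) (x p)).open_source.mem_nhds (mem_chart_source _ _))] with p' hp'
  exact (g.coordForm_trivialization hp' (Y p') (Z p')).symm

/-- Metric compatibility along `x`: in the charts at `p` and `x p` the function is `G(a, b, c)` with
`a` the coordinates of `x`, and the derivative of `G` splits into the Christoffel terms that
complete the derivatives of `b` and `c`. -/
theorem mfderiv_form
    (hY : ContMDiffAt (𝓡 m) (𝓡 n).tangent ∞ (fun p ↦ (⟨x p, Y p⟩ : TangentBundle (𝓡 n) M)) p)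
    (hZ : ContMDiffAt (𝓡 m) (𝓡 n).tangent ∞ (fun p ↦ (⟨x p, Z p⟩ : TangentBundle (𝓡 n) M)) p)
    (v : TangentSpace (𝓡 m) p) :
    mfderiv (𝓡 m) 𝓘(ℝ, ℝ) (fun p ↦ g.form (x p) (Y p) (Z p)) p v =
      g.form (x p) (g.covDerivAlong x Y p v) (Z p) +
        g.form (x p) (Y p) (g.covDerivAlong x Z p v) := by
  have hx : ContMDiffAt (𝓡 m) (𝓡 n) ∞ x p := (contMDiffAt_totalSpace.1 hY).1
  have hxd := hasFDerivAt_extChartAt_comp (hx.mdifferentiableAt (by simp))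
  have hpp : (extChartAt (𝓡 m) p).symm (extChartAt (𝓡 m) p p) = p := by simp
  obtain ⟨L, hL, hLv⟩ := CoordMetric.hasFDerivAt_apply (G := g.coordForm (x p))
    (g.coordForm_symm (x p))
    (by simpa only [hpp] using (g.contDiffAt_coordForm (x p)).differentiableAt (by simp))
    (by simpa only [hpp] using g.isInvertible_coordForm (x p)) hxd
    (hasFDerivAt_coordAlong hY) (hasFDerivAt_coordAlong hZ)
  have hev := g.coordForm_coordAlong_eventuallyEq (Y := Y) (Z := Z) hx.continuousAt
  have hc := (g.contMDiffAt_form hY hZ).continuousAt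
  have hF := (HasFDerivAt.hasMFDerivAt_of_comp_extChartAt_symm (hc.congr hev) hL)
  rw [(hF.congr_of_eventuallyEq hev).mfderiv]
  have hLv' := hLv v
  simp only [hpp, coordAlong_self] at hLv'
  exact hLv'.trans (congrArg₂ (· + ·) (g.coordForm_self (x p) _ _) (g.coordForm_self (x p) _ _))

/-- The chain rule for components; it transfers `∇ξ = 0` from `M` to the field `ξ ∘ x` along `x`. -/
theorem covDerivAlong_comp {ξ : (q : M) → TangentSpace (𝓡 n) q}
    (hξ : ContMDiff (𝓡 n) (𝓡 n).tangent ∞ (fun q ↦ (⟨q, ξ q⟩ : TangentBundle (𝓡 n) M)))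
    (hx : MDifferentiableAt (𝓡 m) (𝓡 n) x p) (v : TangentSpace (𝓡 m) p) :
    g.covDerivAlong x (fun p ↦ ξ (x p)) p v =
      g.covDerivAlong (m := n) (fun q : M ↦ q) ξ (x p) (mfderiv (𝓡 m) (𝓡 n) x p v) := by
  rw [covDerivAlong_apply, covDerivAlong_apply]
  have h := (contMDiffAt_coordAlong (hξ (x p))).mdifferentiableAt (by simp)
  have h2 : coordAlongDeriv x (fun p ↦ ξ (x p)) p =
    (coordAlongDeriv (fun q ↦ q) ξ (x p)).comp (coordDeriv m x p) := mfderiv_comp p h hx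
  have h3 : coordDeriv n (fun q : M ↦ q) (x p) = ContinuousLinearMap.id ℝ _ := mfderiv_id
  rw [h2, h3]
  rfl

end LorentzianMetric

/-! ### Symmetry of the covariant derivative of `dx` -/

namespace LorentzianMetric

section
variable {n m : ℕ} {M : Type*} [TopologicalSpace M] [ChartedSpace (Coord n) M]
  [IsManifold (𝓡 n) ∞ M] (g : LorentzianMetric n M)
  {S : Type*} [TopologicalSpace S] [ChartedSpace (Coord m) S] [IsManifold (𝓡 m) ∞ S]
  {x : S → M} {p : S}

/-- The vector field `dx W` along `x`, where `W` has constant components `w` in the preferred chart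
at `p`. -/
def pushforwardConst (x : S → M) (p : S) (w : Coord m) (p' : S) : TangentSpace (𝓡 n) (x p') :=
  mfderiv (𝓡 m) (𝓡 n) x p'
    ((trivializationAt (Coord m) (TangentSpace (𝓡 m) : S → Type _) p).symmL ℝ p' w)

theorem symmL_self (p : S) (w : TangentSpace (𝓡 m) p) :
    (trivializationAt (Coord m) (TangentSpace (𝓡 m) : S → Type _) p).symmL ℝ p w = w := by
  have hp : p ∈ (trivializationAt (Coord m) (TangentSpace (𝓡 m) : S → Type _) p).baseSet :=
    mem_chart_source (Coord m) p
  have h := Trivialization.symmL_continuousLinearMapAt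
    (trivializationAt (Coord m) (TangentSpace (𝓡 m) : S → Type _) p)
    (R := ℝ) hp w
  rw [Trivialization.continuousLinearMapAt_apply, Trivialization.linearMapAt_apply,
    if_pos hp, trivializationAt_self] at h
  exact h

theorem trivializationAt_eq_mfderiv {q z : M} (hz : z ∈ (chartAt (Coord n) q).source)
    (u : TangentSpace (𝓡 n) z) :
    (trivializationAt (Coord n) (TangentSpace (𝓡 n) : M → Type _) q ⟨z, u⟩).2 =
      mfderiv (𝓡 n) 𝓘(ℝ, Coord n) (extChartAt (𝓡 n) q) z u := by
  have hz' : z ∈ (trivializationAt (Coord n) (TangentSpace (𝓡 n) : M → Type _) q).baseSet := hz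
  have h1 := TangentBundle.continuousLinearMapAt_trivializationAt (I := 𝓡 n) hz
  have h2 := congrFun (Trivialization.continuousLinearMapAt_apply ℝ
    (trivializationAt (Coord n) (TangentSpace (𝓡 n) : M → Type _) q) z) u
  rw [Trivialization.linearMapAt_apply, if_pos hz'] at h2
  exact h2.symm.trans congr($h1 u)

theorem pushforwardConst_self (x : S → M) (p : S) (w : TangentSpace (𝓡 m) p) :
    pushforwardConst x p w p = mfderiv (𝓡 m) (𝓡 n) x p w :=
  congrArg (mfderiv (𝓡 m) (𝓡 n) x p) (symmL_self p w)

theorem contMDiffAt_pushforwardConst (hx : ContMDiff (𝓡 m) (𝓡 n) ∞ x) (w : Coord m) {p' : S}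
    (hp' : p' ∈ (chartAt (Coord m) p).source) :
    ContMDiffAt (𝓡 m) (𝓡 n).tangent ∞
      (fun p' ↦ (⟨x p', pushforwardConst x p w p'⟩ : TangentBundle (𝓡 n) M)) p' :=
  (hx.contMDiff_tangentMap (m := ∞) (by simp)).contMDiffAt.comp p' (contMDiffAt_symmL hp' w)

theorem coordAlong_pushforwardConst (hx : ContMDiff (𝓡 m) (𝓡 n) ∞ x) (w : Coord m) {s : Coord m}
    (hs : s ∈ (extChartAt (𝓡 m) p).target)
    (hxs : x ((extChartAt (𝓡 m) p).symm s) ∈ (chartAt (Coord n) (x p)).source) :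
    coordAlong x (pushforwardConst x p w) p ((extChartAt (𝓡 m) p).symm s) =
      fderiv ℝ (fun s ↦ extChartAt (𝓡 n) (x p) (x ((extChartAt (𝓡 m) p).symm s))) s w := by
  have h1 : MDifferentiableAt (𝓡 n) 𝓘(ℝ, Coord n) (extChartAt (𝓡 n) (x p))
    (x ((extChartAt (𝓡 m) p).symm s)) := mdifferentiableAt_extChartAt hxs
  have h2 : MDifferentiableAt (𝓡 m) (𝓡 n) x ((extChartAt (𝓡 m) p).symm s) :=
    hx.contMDiffAt.mdifferentiableAt (by simp)
  have h3 : MDifferentiableAt 𝓘(ℝ, Coord m) (𝓡 m) (extChartAt (𝓡 m) p).symm s := by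
    have := mdifferentiableWithinAt_extChartAt_symm hs
    rwa [ModelWithCorners.range_eq_univ, mdifferentiableWithinAt_univ] at this
  have hs' : (extChartAt (𝓡 m) p).symm s ∈ (chartAt (Coord m) p).source := by
    simpa using (extChartAt (𝓡 m) p).map_target hs
  have h4 := TangentBundle.symmL_trivializationAt (I := 𝓡 m) hs'
  rw [(extChartAt (𝓡 m) p).right_inv hs, ModelWithCorners.range_eq_univ, mfderivWithin_univ] at h4
  have e1 := mfderiv_comp s (h1.comp _ h2) h3
  have e2 := mfderiv_comp ((extChartAt (𝓡 m) p).symm s) h1 h2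
  rw [mfderiv_eq_fderiv] at e1
  refine (trivializationAt_eq_mfderiv hxs _).trans ?_
  refine Eq.trans ?_ congr($e1 w).symm
  refine Eq.trans ?_ congr($e2 _).symm
  exact congrArg (fun z ↦ mfderiv (𝓡 n) 𝓘(ℝ, Coord n) (extChartAt (𝓡 n) (x p))
    (x ((extChartAt (𝓡 m) p).symm s)) (mfderiv (𝓡 m) (𝓡 n) x ((extChartAt (𝓡 m) p).symm s) z))
    congr($h4 w)

/-- With `X` the coordinate expression of `x`, both sides are `∂_v ∂_w X + Γ(∂_v X, ∂_w X)`: second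
derivatives commute and `Γ` is symmetric. -/
theorem covDerivAlong_pushforwardConst_comm (hx : ContMDiff (𝓡 m) (𝓡 n) ∞ x)
    (v w : TangentSpace (𝓡 m) p) :
    g.covDerivAlong x (pushforwardConst x p w) p v =
      g.covDerivAlong x (pushforwardConst x p v) p w := by
  have hX : ContDiffAt ℝ ∞ (fun s ↦ extChartAt (𝓡 n) (x p) (x ((extChartAt (𝓡 m) p).symm s)))
      (extChartAt (𝓡 m) p p) := by
    have := (contMDiffAt_iff.1 (hx p)).2
    rwa [ModelWithCorners.range_eq_univ, contDiffWithinAt_univ] at this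
  set X : Coord m → Coord n := fun s ↦ extChartAt (𝓡 n) (x p) (x ((extChartAt (𝓡 m) p).symm s))
  have hX' : DifferentiableAt ℝ (fderiv ℝ X) (extChartAt (𝓡 m) p p) :=
    (hX.fderiv_right (m := ∞) (by simp)).differentiableAt (by simp)
  have key : ∀ v w : Coord m, coordAlongDeriv x (pushforwardConst x p w) p v =
      fderiv ℝ (fderiv ℝ X) (extChartAt (𝓡 m) p p) v w := by
    intro v w
    have h1 := hasFDerivAt_coordAlong
      (contMDiffAt_pushforwardConst hx w (mem_chart_source (Coord m) p))
    have h2 : HasFDerivAt (fun s ↦ fderiv ℝ X s w) _ (extChartAt (𝓡 m) p p) :=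
      hX'.hasFDerivAt.clm_apply (hasFDerivAt_const w _)
    have h3 := h1.unique (h2.congr_of_eventuallyEq ?_)
    · simpa using congr($h3 v)
    have hc : ContinuousAt (fun s ↦ x ((extChartAt (𝓡 m) p).symm s)) (extChartAt (𝓡 m) p p) :=
      ContinuousAt.comp (by simpa using hx.continuous.continuousAt)
        (continuousAt_extChartAt_symm p)
    filter_upwards [extChartAt_target_mem_nhds p, hc.preimage_mem_nhds
      ((chartAt (Coord n) (x p)).open_source.mem_nhds (by simp))] with s hs hs'
    exact coordAlong_pushforwardConst hx w hs hs'
  have hsymm := (hX.isSymmSndFDerivAt (by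
    rw [minSmoothness_of_isRCLikeNormedField]
    exact WithTop.coe_le_coe.2 le_top)).eq v w
  rw [covDerivAlong_apply, covDerivAlong_apply, pushforwardConst_self, pushforwardConst_self]
  refine congrArg₂ (· + ·) ((key v w).trans (hsymm.trans (key w v).symm)) ?_
  exact CoordMetric.christoffel_comm (g.coordForm_symm (x p))
    ((g.contDiffAt_coordForm (x p)).differentiableAt (by simp)) _ _

end

end LorentzianMetric

/-! ### Traceless endomorphisms of a plane -/

namespace LinearMap

/-- Cayley-Hamilton reads `A² = -det(A) id` when the trace vanishes; taking traces identifies the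
scalar as half the trace of `A²`. -/
theorem comp_self_eq_smul_id_of_trace_eq_zero {V : Type*} [AddCommGroup V] [Module ℝ V]
    (hV : Module.finrank ℝ V = 2) (A : V →ₗ[ℝ] V) (hA : LinearMap.trace ℝ V A = 0) :
    A ∘ₗ A = (1 / 2 * LinearMap.trace ℝ V (A ∘ₗ A)) • LinearMap.id := by
  have : FiniteDimensional ℝ V := Module.finite_of_finrank_eq_succ hV
  let b := Module.finBasisOfFinrankEq ℝ V hV
  rw [LinearMap.trace_eq_matrix_trace ℝ b] at hA ⊢
  apply (LinearMap.toMatrix b b).injective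
  rw [map_smul, LinearMap.toMatrix_comp b b b, LinearMap.toMatrix_id]
  set B := LinearMap.toMatrix b b A
  have h11 : B 1 1 = -B 0 0 := by
    rw [Matrix.trace_fin_two] at hA
    linarith
  ext i j
  fin_cases i <;> fin_cases j <;>
    simp [Matrix.mul_apply, Fin.sum_univ_two, Matrix.trace_fin_two, h11] <;> ring

end LinearMap

/-! ### Shape operator and second fundamental form in codimension one -/

namespace LorentzianMetric

section
variable {n m : ℕ} {M : Type*} [TopologicalSpace M] [ChartedSpace (Coord n) M]
  [IsManifold (𝓡 n) ∞ M] {g : LorentzianMetric n M}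
  {S : Type*} [TopologicalSpace S] [ChartedSpace (Coord m) S] [IsManifold (𝓡 m) ∞ S]
  [RiemannianBundle (fun p : S ↦ TangentSpace (𝓡 m) p)]
  {x : S → M} {N : (p : S) → TangentSpace (𝓡 n) (x p)}

theorem inner_sharp (p : S) (ℓ : TangentSpace (𝓡 m) p →L[ℝ] ℝ) (w : TangentSpace (𝓡 m) p) :
    inner ℝ (sharp p ℓ) w = ℓ w := by
  have : FiniteDimensional ℝ (TangentSpace (𝓡 m) p) :=
    inferInstanceAs (FiniteDimensional ℝ (Coord m))
  have : CompleteSpace (TangentSpace (𝓡 m) p) := FiniteDimensional.complete ℝ _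
  exact InnerProductSpace.toDual_symm_apply

theorem inner_tangentPart (p : S) (z : TangentSpace (𝓡 n) (x p)) (w : TangentSpace (𝓡 m) p) :
    inner ℝ (g.tangentPart x p z) w = g.form (x p) z (mfderiv (𝓡 m) (𝓡 n) x p w) :=
  inner_sharp p _ w

/-- In codimension one, the tangent space and a nonzero normal vector span. -/
theorem exists_eq_smul_add_mfderiv (hx : g.IsIsometricImmersion (m := m) x) (hnm : n = m + 1)
    (p : S) {ν : TangentSpace (𝓡 n) (x p)} (hν : ν ≠ 0)
    (hνx : ∀ v : TangentSpace (𝓡 m) p, g.form (x p) ν (mfderiv (𝓡 m) (𝓡 n) x p v) = 0)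
    (z : TangentSpace (𝓡 n) (x p)) :
    ∃ (t : ℝ) (v : TangentSpace (𝓡 m) p), z = t • ν + mfderiv (𝓡 m) (𝓡 n) x p v := by
  let L : ℝ × TangentSpace (𝓡 m) p →ₗ[ℝ] TangentSpace (𝓡 n) (x p) :=
    (LinearMap.toSpanSingleton ℝ _ ν).coprod (mfderiv (𝓡 m) (𝓡 n) x p).toLinearMap
  have hL : ∀ t v, L (t, v) = t • ν + mfderiv (𝓡 m) (𝓡 n) x p v := fun t v ↦ rfl
  have : FiniteDimensional ℝ (TangentSpace (𝓡 m) p) :=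
    inferInstanceAs (FiniteDimensional ℝ (Coord m))
  have : FiniteDimensional ℝ (TangentSpace (𝓡 n) (x p)) :=
    inferInstanceAs (FiniteDimensional ℝ (Coord n))
  have hm : Module.finrank ℝ (TangentSpace (𝓡 m) p) = m :=
    (finrank_euclideanSpace (𝕜 := ℝ) (ι := Fin m)).trans (Fintype.card_fin m)
  have hn : Module.finrank ℝ (TangentSpace (𝓡 n) (x p)) = n :=
    (finrank_euclideanSpace (𝕜 := ℝ) (ι := Fin n)).trans (Fintype.card_fin n)
  -- Pairing with `dx v` removes the `ν` term and leaves `|v|² = 0`. The causal character of `ν`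
  -- plays no role, so a lightlike `ν` is allowed too.
  have hinj : Function.Injective L := by
    rw [injective_iff_map_eq_zero]
    rintro ⟨t, v⟩ htv
    rw [hL] at htv
    have hv : inner ℝ v v = 0 := by
      have h := congrArg (g.form (x p) (mfderiv (𝓡 m) (𝓡 n) x p v)) htv
      rwa [map_add, map_smul, g.symm _ _ ν, hνx, smul_zero, zero_add, hx.isometric,
        map_zero] at h
    rw [inner_self_eq_zero] at hv
    rw [hv, map_zero, add_zero, smul_eq_zero, or_iff_left hν] at htv
    rw [hv, htv]
    rfl
  have hsurj : Function.Surjective L := by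
    refine (LinearMap.injective_iff_surjective_of_finrank_eq_finrank ?_).1 hinj
    rw [Module.finrank_prod, hm, hn, Module.finrank_self, hnm, add_comm]
  obtain ⟨⟨t, v⟩, h⟩ := hsurj z
  exact ⟨t, v, h.symm⟩

/-- In codimension one, a vector orthogonal to the normal and to the tangent space is zero. -/
theorem eq_zero_of_form_normal_of_form_tangent (hx : g.IsIsometricImmersion (m := m) x)
    (hN : g.IsUnitNormal (m := m) x N) (hnm : n = m + 1) (p : S) {z : TangentSpace (𝓡 n) (x p)}
    (h1 : g.form (x p) z (N p) = 0)
    (h2 : ∀ v : TangentSpace (𝓡 m) p, g.form (x p) z (mfderiv (𝓡 m) (𝓡 n) x p v) = 0) :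
    z = 0 := by
  have hN0 : N p ≠ 0 := fun h ↦ by
    have := hN.unit p
    rw [h] at this
    simp at this
  refine g.eq_zero_of_form_eq_zero _ z fun w ↦ ?_
  obtain ⟨t, v, rfl⟩ := exists_eq_smul_add_mfderiv hx hnm p hN0 (hN.normal p) w
  rw [map_add, map_smul, h1, h2]
  simp

theorem inner_shapeOperator (p : S) (v w : TangentSpace (𝓡 m) p) :
    inner ℝ (g.shapeOperator x N p v) w =
      -g.form (x p) (g.covDerivAlong x N p v) (mfderiv (𝓡 m) (𝓡 n) x p w) := by
  rw [← inner_tangentPart, ← inner_neg_left]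
  rfl

/-- Differentiate `g(dx W, N) = 0`. The right side no longer differentiates `N`, so its symmetry in
`v, w` is that of `∇ dx`. -/
theorem inner_shapeOperator_eq (hx : g.IsIsometricImmersion (m := m) x)
    (hN : g.IsUnitNormal (m := m) x N) (p : S) (v w : TangentSpace (𝓡 m) p) :
    inner ℝ (g.shapeOperator x N p v) w =
      g.form (x p) (g.covDerivAlong x (pushforwardConst x p w) p v) (N p) := by
  have h := g.mfderiv_form
    (contMDiffAt_pushforwardConst hx.contMDiff w (mem_chart_source (Coord m) p))
    hN.contMDiff.contMDiffAt v
  have h0 : (fun p' ↦ g.form (x p') (pushforwardConst x p w p') (N p')) = fun _ ↦ (0 : ℝ) := by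
    funext p'
    rw [g.symm]
    exact hN.normal p' _
  rw [h0, mfderiv_const, pushforwardConst_self] at h
  rw [inner_shapeOperator, g.symm]
  have h' : (0 : ℝ) = _ := h
  linarith

theorem inner_shapeOperator_comm (hx : g.IsIsometricImmersion (m := m) x)
    (hN : g.IsUnitNormal (m := m) x N) (p : S) (v w : TangentSpace (𝓡 m) p) :
    inner ℝ (g.shapeOperator x N p v) w = inner ℝ (g.shapeOperator x N p w) v := by
  rw [inner_shapeOperator_eq hx hN, inner_shapeOperator_eq hx hN,
    covDerivAlong_pushforwardConst_comm g hx.contMDiff]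

theorem secondFundamentalForm_eq (p : S) (v w : TangentSpace (𝓡 m) p) :
    g.secondFundamentalForm x p v w = g.covDerivAlong x (pushforwardConst x p w) p v -
      mfderiv (𝓡 m) (𝓡 n) x p
        (g.tangentPart x p (g.covDerivAlong x (pushforwardConst x p w) p v)) := rfl

theorem form_secondFundamentalForm_normal (hx : g.IsIsometricImmersion (m := m) x)
    (hN : g.IsUnitNormal (m := m) x N) (p : S) (v w : TangentSpace (𝓡 m) p) :
    g.form (x p) (g.secondFundamentalForm x p v w) (N p) =
      inner ℝ (g.shapeOperator x N p v) w := by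
  rw [secondFundamentalForm_eq, inner_shapeOperator_eq hx hN, map_sub,
    sub_apply, g.symm _ (mfderiv _ _ _ _ _), hN.normal, sub_zero]

theorem form_sub_tangentPart (hx : g.IsIsometricImmersion (m := m) x) (p : S)
    (z : TangentSpace (𝓡 n) (x p)) (u : TangentSpace (𝓡 m) p) :
    g.form (x p) (z - mfderiv (𝓡 m) (𝓡 n) x p (g.tangentPart x p z))
      (mfderiv (𝓡 m) (𝓡 n) x p u) = 0 := by
  rw [map_sub, sub_apply, hx.isometric, inner_tangentPart, sub_self]

/-- The second fundamental form has no tangent component, so it is determined by its product with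
`N`. -/
theorem secondFundamentalForm_eq_zero_iff (hx : g.IsIsometricImmersion (m := m) x)
    (hN : g.IsUnitNormal (m := m) x N) (hnm : n = m + 1) (p : S) (v w : TangentSpace (𝓡 m) p) :
    g.secondFundamentalForm x p v w = 0 ↔ inner ℝ (g.shapeOperator x N p v) w = 0 := by
  rw [← form_secondFundamentalForm_normal hx hN]
  refine ⟨fun h ↦ by simp [h], fun h ↦ ?_⟩
  refine eq_zero_of_form_normal_of_form_tangent hx hN hnm p h fun u ↦ form_sub_tangentPart hx p _ u

theorem isTotallyGeodesic_iff (hx : g.IsIsometricImmersion (m := m) x)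
    (hN : g.IsUnitNormal (m := m) x N) (hnm : n = m + 1) :
    g.IsTotallyGeodesic (m := m) x ↔ ∀ p, g.shapeOperator (m := m) x N p = 0 := by
  constructor
  · intro h p
    ext1 v
    refine ext_inner_right ℝ fun w ↦ ?_
    rw [(secondFundamentalForm_eq_zero_iff hx hN hnm p v w).1 (h p v w)]
    exact (inner_zero_left w).symm
  · intro h p v w
    rw [secondFundamentalForm_eq_zero_iff hx hN hnm, h]
    simp

theorem trace_shapeOperator (hx : g.IsIsometricImmersion (m := m) x)
    (hN : g.IsUnitNormal (m := m) x N) (hmax : g.IsMaximal (m := m) x) (hm : m ≠ 0) (p : S) :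
    LinearMap.trace ℝ (TangentSpace (𝓡 m) p) (g.shapeOperator x N p) = 0 := by
  have : FiniteDimensional ℝ (TangentSpace (𝓡 m) p) :=
    inferInstanceAs (FiniteDimensional ℝ (Coord m))
  rw [LinearMap.trace_eq_sum_inner _ (stdOrthonormalBasis ℝ (TangentSpace (𝓡 m) p))]
  have h := (smul_eq_zero_iff_right (by positivity)).1 (hmax p)
  have h2 := congrArg (g.form (x p) (N p)) h
  rw [map_sum, map_zero] at h2
  rw [← h2]
  refine Finset.sum_congr rfl fun i _ ↦ ?_
  rw [g.symm, form_secondFundamentalForm_normal hx hN, real_inner_comm]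

/-- Differentiate `g(N, N) = -1`. -/
theorem form_covDerivAlong_normal (hN : g.IsUnitNormal (m := m) x N) (p : S)
    (v : TangentSpace (𝓡 m) p) : g.form (x p) (g.covDerivAlong x N p v) (N p) = 0 := by
  have h := g.mfderiv_form hN.contMDiff.contMDiffAt hN.contMDiff.contMDiffAt v
  have h0 : (fun p' ↦ g.form (x p') (N p') (N p')) = fun _ ↦ (-1 : ℝ) := funext hN.unit
  rw [h0, mfderiv_const] at h
  have h' : (0 : ℝ) = g.form (x p) (g.covDerivAlong x N p v) (N p) +
    g.form (x p) (N p) (g.covDerivAlong x N p v) := h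
  rw [g.symm _ (N p)] at h'
  linarith

/-! ### The gradient of `η = g(N, ξ)` -/

section Parallel
variable {ξ : (q : M) → TangentSpace (𝓡 n) q}

/-- The normal component carries a minus sign because `g(N, N) = -1`. -/
theorem eq_tangentPart_sub_smul_normal (hx : g.IsIsometricImmersion (m := m) x)
    (hN : g.IsUnitNormal (m := m) x N) (hnm : n = m + 1) (p : S) (z : TangentSpace (𝓡 n) (x p)) :
    z = mfderiv (𝓡 m) (𝓡 n) x p (g.tangentPart x p z) - g.form (x p) (N p) z • N p := by
  rw [← sub_eq_zero]
  refine eq_zero_of_form_normal_of_form_tangent hx hN hnm p ?_ fun u ↦ ?_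
  · rw [g.symm, map_sub, map_sub, hN.normal, map_smul, hN.unit]
    simp
  · rw [← sub_add, map_add, add_apply, form_sub_tangentPart hx, map_smul,
      smul_apply, hN.normal]
    simp

theorem mfderiv_form_normal (hx : g.IsIsometricImmersion (m := m) x)
    (hN : g.IsUnitNormal (m := m) x N) (hnm : n = m + 1) (hξ : g.IsParallelLightlike ξ) (p : S)
    (v : TangentSpace (𝓡 m) p) :
    mfderiv (𝓡 m) 𝓘(ℝ, ℝ) (fun p ↦ g.form (x p) (N p) (ξ (x p))) p v =
      -inner ℝ (g.shapeOperator x N p v) (g.tangentPart x p (ξ (x p))) := by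
  have h1 := hξ.contMDiff.contMDiffAt.comp p hx.contMDiff.contMDiffAt
  rw [g.mfderiv_form (Z := fun p ↦ ξ (x p)) hN.contMDiff.contMDiffAt h1,
    g.covDerivAlong_comp hξ.contMDiff (hx.contMDiff.contMDiffAt.mdifferentiableAt (by simp)), hξ.parallel, LinearMap.zero_apply,
    map_zero, add_zero, inner_shapeOperator, neg_neg]
  -- Only the tangent part of `ξ` contributes, since `∇_v N` is orthogonal to `N`.
  conv_lhs => rw [eq_tangentPart_sub_smul_normal hx hN hnm p (ξ (x p))]
  rw [map_sub, map_smul, form_covDerivAlong_normal hN, smul_zero, sub_zero]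

theorem gradient_form_normal (hx : g.IsIsometricImmersion (m := m) x)
    (hN : g.IsUnitNormal (m := m) x N) (hnm : n = m + 1) (hξ : g.IsParallelLightlike ξ) (p : S) :
    gradient (m := m) (fun p ↦ g.form (x p) (N p) (ξ (x p))) p =
      -g.shapeOperator x N p (g.tangentPart x p (ξ (x p))) := by
  refine ext_inner_right ℝ fun v ↦ ?_
  refine (inner_sharp p _ v).trans ((mfderiv_form_normal hx hN hnm hξ p v).trans ?_)
  rw [inner_neg_left, inner_shapeOperator_comm hx hN]

/-- Pairing `ξ = dx T - η N` with the lightlike `ξ` gives `0 = |T|² - η²`. -/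
theorem inner_tangentPart_self (hx : g.IsIsometricImmersion (m := m) x)
    (hN : g.IsUnitNormal (m := m) x N) (hnm : n = m + 1) (hξ : g.IsParallelLightlike ξ) (p : S) :
    inner ℝ (g.tangentPart (m := m) x p (ξ (x p))) (g.tangentPart x p (ξ (x p))) =
      g.form (x p) (N p) (ξ (x p)) ^ 2 := by
  rw [inner_tangentPart]
  have h := eq_tangentPart_sub_smul_normal hx hN hnm p (ξ (x p))
  have h2 := congrArg (g.form (x p) (ξ (x p))) h
  rw [hξ.lightlike, map_sub, map_smul, g.symm _ (ξ (x p)) (N p), smul_eq_mul] at h2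
  linarith

end Parallel
end

end LorentzianMetric

/-! ### Functions with vanishing differential -/

theorem isLocallyConstant_of_mfderiv_eq_zero {m : ℕ} {S : Type*} [TopologicalSpace S]
    [ChartedSpace (Coord m) S] [IsManifold (𝓡 m) ∞ S] {f : S → ℝ}
    (hf : MDifferentiable (𝓡 m) 𝓘(ℝ, ℝ) f)
    (h : ∀ p, mfderiv (𝓡 m) 𝓘(ℝ, ℝ) f p = 0) : IsLocallyConstant f := by
  rw [IsLocallyConstant.iff_eventually_eq]
  intro p
  obtain ⟨r, hr, hball⟩ := Metric.mem_nhds_iff.1 (extChartAt_target_mem_nhds (I := 𝓡 m) p)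
  have key : ∀ s ∈ Metric.ball (extChartAt (𝓡 m) p p) r,
      HasFDerivAt (f ∘ (extChartAt (𝓡 m) p).symm) (0 : Coord m →L[ℝ] ℝ) s := by
    intro s hs
    have h3 : MDifferentiableAt 𝓘(ℝ, Coord m) (𝓡 m) (extChartAt (𝓡 m) p).symm s := by
      have := mdifferentiableWithinAt_extChartAt_symm (hball hs)
      rwa [ModelWithCorners.range_eq_univ, mdifferentiableWithinAt_univ] at this
    have h4 := (hf ((extChartAt (𝓡 m) p).symm s)).hasMFDerivAt.comp s h3.hasMFDerivAt
    rw [h] at h4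
    exact h4.hasFDerivAt
  have hmem : ∀ᶠ q in nhds p, q ∈ (extChartAt (𝓡 m) p).source ∧
      extChartAt (𝓡 m) p q ∈ Metric.ball (extChartAt (𝓡 m) p p) r :=
    Filter.Eventually.and (extChartAt_source_mem_nhds p)
      ((continuousAt_extChartAt p).preimage_mem_nhds (Metric.ball_mem_nhds _ hr))
  filter_upwards [hmem] with q hq
  have := Metric.isOpen_ball.is_const_of_fderiv_eq_zero (𝕜 := ℝ) (convex_ball _ r).isPreconnected
    (fun s hs ↦ (key s hs).differentiableAt.differentiableWithinAt)
    (fun s hs ↦ (key s hs).fderiv) hq.2 (Metric.mem_ball_self hr)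
  simpa only [Function.comp_apply, (extChartAt (𝓡 m) p).left_inv hq.1,
    extChartAt_to_inv p] using this

/-! ### Smoothness of fields along `x` -/

namespace LorentzianMetric

section
variable {n m : ℕ} {M : Type*} [TopologicalSpace M] [ChartedSpace (Coord n) M]
  [IsManifold (𝓡 n) ∞ M] {g : LorentzianMetric n M}
  {S : Type*} [TopologicalSpace S] [ChartedSpace (Coord m) S]
  {x : S → M}

theorem contMDiffAt_smul_sub_along {f : S → ℝ} {Y Z : (p : S) → TangentSpace (𝓡 n) (x p)} {p : S}
    (hf : ContMDiffAt (𝓡 m) 𝓘(ℝ, ℝ) ∞ f p)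
    (hY : ContMDiffAt (𝓡 m) (𝓡 n).tangent ∞ (fun p ↦ (⟨x p, Y p⟩ : TangentBundle (𝓡 n) M)) p)
    (hZ : ContMDiffAt (𝓡 m) (𝓡 n).tangent ∞ (fun p ↦ (⟨x p, Z p⟩ : TangentBundle (𝓡 n) M)) p) :
    ContMDiffAt (𝓡 m) (𝓡 n).tangent ∞
      (fun p ↦ (⟨x p, f p • (Y p - Z p)⟩ : TangentBundle (𝓡 n) M)) p := by
  have hx : ContMDiffAt (𝓡 m) (𝓡 n) ∞ x p := (contMDiffAt_totalSpace.1 hY).1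
  refine contMDiffAt_totalSpace.2 ⟨hx, ?_⟩
  refine (hf.smul ((contMDiffAt_coordAlong hY).sub
    (contMDiffAt_coordAlong hZ))).congr_of_eventuallyEq ?_
  filter_upwards [hx.continuousAt.preimage_mem_nhds
    ((chartAt (Coord n) (x p)).open_source.mem_nhds (mem_chart_source _ _))] with p' hp'
  refine (trivializationAt_eq_mfderiv hp' _).trans ?_
  rw [map_smul, map_sub, ← trivializationAt_eq_mfderiv hp', ← trivializationAt_eq_mfderiv hp']
  rfl

variable [IsManifold (𝓡 m) ∞ S] [RiemannianBundle (fun p : S ↦ TangentSpace (𝓡 m) p)]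

/-- In the chart frame at `p`, the components of the tangent part solve a linear system: the Gram
form `H` of the induced metric against the form `ℓ = g(Z, dx ·)`. Both are smooth and inversion is
smooth at an invertible map. -/
theorem contMDiffAt_tangentPart (hx : g.IsIsometricImmersion (m := m) x)
    {Z : (p : S) → TangentSpace (𝓡 n) (x p)} {p : S}
    (hZ : ContMDiffAt (𝓡 m) (𝓡 n).tangent ∞ (fun p ↦ (⟨x p, Z p⟩ : TangentBundle (𝓡 n) M)) p) :
    ContMDiffAt (𝓡 m) (𝓡 m).tangent ∞
      (fun p ↦ (⟨p, g.tangentPart x p (Z p)⟩ : TangentBundle (𝓡 m) S)) p := by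
  let e := trivializationAt (Coord m) (TangentSpace (𝓡 m) : S → Type _) p
  let P : (p' : S) → Coord m →L[ℝ] TangentSpace (𝓡 n) (x p') := fun p' ↦
    mfderiv (𝓡 m) (𝓡 n) x p' ∘L e.symmL ℝ p'
  let H : S → Coord m →L[ℝ] Coord m →L[ℝ] ℝ := fun p' ↦
    (P p').precomp ℝ ∘L g.form (x p') ∘L P p'
  let ℓ : S → Coord m →L[ℝ] ℝ := fun p' ↦ g.form (x p') (Z p') ∘L P p'
  have hPsmooth := fun w : Coord m ↦
    contMDiffAt_pushforwardConst hx.contMDiff w (mem_chart_source (Coord m) p)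
  have hH : ContMDiffAt (𝓡 m) 𝓘(ℝ, Coord m →L[ℝ] Coord m →L[ℝ] ℝ) ∞ H p :=
    .of_clm_apply fun a ↦ .of_clm_apply fun b ↦ g.contMDiffAt_form (hPsmooth a) (hPsmooth b)
  have hℓ : ContMDiffAt (𝓡 m) 𝓘(ℝ, Coord m →L[ℝ] ℝ) ∞ ℓ p :=
    .of_clm_apply fun b ↦ g.contMDiffAt_form hZ (hPsmooth b)
  have hHapp : ∀ (p' : S) (a b : Coord m),
      H p' a b = inner ℝ (e.symmL ℝ p' a) (e.symmL ℝ p' b) := fun p' a b ↦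
    hx.isometric p' _ _
  have hinv : ∀ p' ∈ e.baseSet, (H p').IsInvertible := fun p' hp' ↦ by
    refine ContinuousLinearMap.isInvertible_of_injective_dual
      ((injective_iff_map_eq_zero _).2 fun a ha ↦ ?_)
    have h1 : inner ℝ (e.symmL ℝ p' a) (e.symmL ℝ p' a) = 0 := by
      rw [← hHapp, ha]
      rfl
    rw [inner_self_eq_zero] at h1
    rw [← e.continuousLinearMapAt_symmL (R := ℝ) hp' a, h1, map_zero]
  have hinvs : ContMDiffAt (𝓡 m) 𝓘(ℝ, Coord m) ∞ (fun p' ↦ (H p').inverse (ℓ p')) p := by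
    obtain ⟨B, hB⟩ := hinv p (mem_chart_source (Coord m) p)
    have h1 : ContDiffAt ℝ ∞ ContinuousLinearMap.inverse (H p) := by
      rw [← hB]
      exact contDiffAt_map_inverse B
    exact (h1.contMDiffAt.comp p hH).clm_apply hℓ
  refine contMDiffAt_totalSpace.2 ⟨contMDiffAt_id, hinvs.congr_of_eventuallyEq ?_⟩
  filter_upwards [e.open_baseSet.mem_nhds (mem_chart_source (Coord m) p)] with p' hp'
  have hT : g.tangentPart x p' (Z p') = e.symmL ℝ p' ((H p').inverse (ℓ p')) := by
    refine ext_inner_right ℝ fun w ↦ ?_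
    rw [← e.symmL_continuousLinearMapAt (R := ℝ) hp' w, ← hHapp, (hinv p' hp').self_apply_inverse,
      inner_tangentPart]
    rfl
  change (e ⟨p', g.tangentPart x p' (Z p')⟩).2 = _
  rw [hT, Trivialization.symmL_apply _ hp']
  exact congrArg Prod.snd (e.apply_mk_symm hp' _)

end
end LorentzianMetric

/-! ### The unit normal determined by `ξ` -/

namespace LorentzianMetric

section
variable {n m : ℕ} {M : Type*} [TopologicalSpace M] [ChartedSpace (Coord n) M]
  [IsManifold (𝓡 n) ∞ M] {g : LorentzianMetric n M}
  {S : Type*} [TopologicalSpace S] [ChartedSpace (Coord m) S] [IsManifold (𝓡 m) ∞ S]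
  [RiemannianBundle (fun p : S ↦ TangentSpace (𝓡 m) p)]
  {x : S → M} {ξ : (q : M) → TangentSpace (𝓡 n) q}

/-- The tangent part of a lightlike vector on a spacelike hypersurface does not vanish. -/
theorem tangentPart_ne_zero (hx : g.IsIsometricImmersion (m := m) x) (hnm : n = m + 1) (p : S)
    {z : TangentSpace (𝓡 n) (x p)} (hz : z ≠ 0) (hzz : g.form (x p) z z = 0) :
    g.tangentPart (m := m) x p z ≠ 0 := by
  intro h
  -- A lightlike normal `z` would span the ambient space together with the tangent space, so every
  -- vector `t z + dx v` would have square `|v|² ≥ 0`, and none would be timelike.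
  have hzx : ∀ v : TangentSpace (𝓡 m) p, g.form (x p) z (mfderiv (𝓡 m) (𝓡 n) x p v) = 0 :=
    fun v ↦ by rw [← inner_tangentPart, h, inner_zero_left]
  obtain ⟨u, hu, -⟩ := g.signature (x p)
  obtain ⟨t, v, rfl⟩ := exists_eq_smul_add_mfderiv hx hnm p hz hzx u
  have e1 : g.form (x p) z (t • z + mfderiv (𝓡 m) (𝓡 n) x p v) = 0 := by
    rw [map_add, map_smul, hzz, hzx, smul_zero, add_zero]
  have e2 : g.form (x p) (mfderiv (𝓡 m) (𝓡 n) x p v)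
      (t • z + mfderiv (𝓡 m) (𝓡 n) x p v) = inner ℝ v v := by
    rw [map_add, map_smul, g.symm _ _ z, hzx, hx.isometric, smul_zero, zero_add]
  rw [map_add (g.form (x p)), add_apply, map_smul, smul_apply, e1, e2, smul_zero, zero_add] at hu
  exact hu.not_ge real_inner_self_nonneg

/-- The normal vector `ν = dx T - ξ` satisfies `g(ν, ξ) = |T|²` and `g(ν, ν) = -|T|²`, so `ν / |T|`
is a unit normal with the right sign. Unit normals at a point agree up to sign, and the sign of
`g(N, ξ)` decides. -/
theorem existsUnique_unitNormal (hx : g.IsIsometricImmersion (m := m) x) (hnm : n = m + 1)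
    (hξ : g.IsParallelLightlike ξ) :
    ∃! N : (p : S) → TangentSpace (𝓡 n) (x p),
      g.IsUnitNormal (m := m) x N ∧ ∀ p, 0 < g.form (x p) (N p) (ξ (x p)) := by
  refine existsUnique_of_exists_of_unique ?_ ?_
  · let T : (p : S) → TangentSpace (𝓡 m) p := fun p ↦ g.tangentPart x p (ξ (x p))
    let ν : (p : S) → TangentSpace (𝓡 n) (x p) := fun p ↦
      mfderiv (𝓡 m) (𝓡 n) x p (T p) - ξ (x p)
    have hTpos : ∀ p, 0 < inner ℝ (T p) (T p) := fun p ↦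
      real_inner_self_pos.2 (tangentPart_ne_zero hx hnm p (hξ.ne_zero _) (hξ.lightlike _))
    have hνx : ∀ (p : S) (v : TangentSpace (𝓡 m) p),
        g.form (x p) (ν p) (mfderiv (𝓡 m) (𝓡 n) x p v) = 0 := fun p v ↦ by
      rw [map_sub, sub_apply, hx.isometric, inner_tangentPart, sub_self]
    have hνξ : ∀ p, g.form (x p) (ν p) (ξ (x p)) = inner ℝ (T p) (T p) := fun p ↦ by
      rw [map_sub, sub_apply, hξ.lightlike, sub_zero, g.symm, ← inner_tangentPart]
    have hνν : ∀ p, g.form (x p) (ν p) (ν p) = -inner ℝ (T p) (T p) := fun p ↦ by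
      rw [← hνξ]
      conv_lhs => rw [map_sub, hνx, zero_sub]
    have hξx : ContMDiff (𝓡 m) (𝓡 n).tangent ∞
        (fun p ↦ (⟨x p, ξ (x p)⟩ : TangentBundle (𝓡 n) M)) := hξ.contMDiff.comp hx.contMDiff
    have hTs : ContMDiff (𝓡 m) (𝓡 m).tangent ∞ (fun p ↦ (⟨p, T p⟩ : TangentBundle (𝓡 m) S)) :=
      fun p ↦ contMDiffAt_tangentPart hx (hξx p)
    have hdT : ContMDiff (𝓡 m) (𝓡 n).tangent ∞
        (fun p ↦ (⟨x p, mfderiv (𝓡 m) (𝓡 n) x p (T p)⟩ : TangentBundle (𝓡 n) M)) :=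
      (hx.contMDiff.contMDiff_tangentMap (m := ∞) (by simp)).comp hTs
    let f : S → ℝ := fun p ↦ (Real.sqrt (inner ℝ (T p) (T p)))⁻¹
    have hf : ∀ p, ContMDiffAt (𝓡 m) 𝓘(ℝ, ℝ) ∞ f p := fun p ↦ by
      have h1 : ContMDiffAt (𝓡 m) 𝓘(ℝ, ℝ) ∞ (fun p ↦ inner ℝ (T p) (T p)) p := by
        simpa only [hx.isometric] using g.contMDiffAt_form (hdT p) (hdT p)
      have h2 : ContDiffAt ℝ ∞ (fun t : ℝ ↦ (Real.sqrt t)⁻¹) (inner ℝ (T p) (T p)) :=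
        (Real.contDiffAt_sqrt (hTpos p).ne').inv (Real.sqrt_pos.2 (hTpos p)).ne'
      exact ContMDiffAt.comp (g := fun t : ℝ ↦ (Real.sqrt t)⁻¹) p h2.contMDiffAt h1
    have hfpos : ∀ p, 0 < f p := fun p ↦ inv_pos.2 (Real.sqrt_pos.2 (hTpos p))
    have hfsq : ∀ p, f p * f p * inner ℝ (T p) (T p) = 1 := fun p ↦ by
      rw [← mul_inv, Real.mul_self_sqrt (hTpos p).le, inv_mul_cancel₀ (hTpos p).ne']
    refine ⟨fun p ↦ f p • ν p, ⟨fun p ↦ contMDiffAt_smul_sub_along (hf p) (hdT p) (hξx p),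
      fun p ↦ ?_, fun p v ↦ ?_⟩, fun p ↦ ?_⟩
    · rw [map_smul, map_smul, smul_apply, hνν, smul_eq_mul, smul_eq_mul]
      linarith [hfsq p]
    · rw [map_smul, smul_apply, hνx, smul_zero]
    · rw [map_smul, smul_apply, hνξ]
      exact mul_pos (hfpos p) (hTpos p)
  · rintro N N' ⟨hN, hNξ⟩ ⟨hN', hNξ'⟩
    funext p
    have h0 := hN.unit p
    -- The component of `N'` orthogonal to `N`, with a plus sign because `g(N, N) = -1`; being also
    -- normal to the surface, it vanishes.
    have key : N' p + g.form (x p) (N' p) (N p) • N p = 0 :=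
      eq_zero_of_form_normal_of_form_tangent hx hN hnm p
        (by rw [map_add, map_smul, add_apply, smul_apply, hN.unit]; simp)
        (fun v ↦ by rw [map_add, map_smul, add_apply, smul_apply, hN.normal, hN'.normal]; simp)
    generalize g.form (x p) (N' p) (N p) = c at key
    have hN'p : N' p = (-c) • N p := by rw [neg_smul]; exact eq_neg_of_add_eq_zero_left key
    have h1 := hN'.unit p
    have h2 := hNξ' p
    rw [hN'p, map_smul, map_smul, smul_apply, hN.unit, smul_eq_mul, smul_eq_mul] at h1
    rw [hN'p, map_smul, smul_apply, smul_eq_mul] at h2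
    have h3 : 0 < -c := pos_of_mul_pos_left h2 (hNξ p).le
    have h4 : -c = 1 := by nlinarith
    rw [hN'p, h4, one_smul]

theorem gradient_eq_zero_iff_mfderiv_eq_zero (f : S → ℝ) (p : S) :
    gradient (m := m) f p = 0 ↔ mfderiv (𝓡 m) 𝓘(ℝ, ℝ) f p = 0 := by
  constructor
  · intro h
    ext1 v
    refine (inner_sharp p (mfderiv (𝓡 m) 𝓘(ℝ, ℝ) f p) v).symm.trans ?_
    change inner ℝ (gradient f p) v = 0
    rw [h, inner_zero_left]
  · intro h
    refine ext_inner_right ℝ fun v ↦ ?_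
    refine (inner_sharp p (mfderiv (𝓡 m) 𝓘(ℝ, ℝ) f p) v).trans ?_
    rw [h, inner_zero_left]
    rfl

/-- On a maximal spacelike surface `A² = ½ trace(A²)`. -/
theorem inner_shapeOperator_shapeOperator
    {N : (p : S) → TangentSpace (𝓡 n) (x p)} (hm : m = 2)
    (hx : g.IsIsometricImmersion (m := m) x) (hN : g.IsUnitNormal (m := m) x N)
    (hmax : g.IsMaximal (m := m) x) (p : S) (v : TangentSpace (𝓡 m) p) :
    inner ℝ (g.shapeOperator x N p v) (g.shapeOperator x N p v) =
      1 / 2 * LinearMap.trace ℝ (TangentSpace (𝓡 m) p)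
        (g.shapeOperator x N p ∘ₗ g.shapeOperator x N p) * inner ℝ v v := by
  have hfin : Module.finrank ℝ (TangentSpace (𝓡 m) p) = 2 :=
    (finrank_euclideanSpace (𝕜 := ℝ) (ι := Fin m)).trans ((Fintype.card_fin m).trans hm)
  have h := LinearMap.comp_self_eq_smul_id_of_trace_eq_zero hfin _
    (trace_shapeOperator hx hN hmax (by omega) p)
  -- Self-adjointness turns `⟨A v, A v⟩` into `⟨A (A v), v⟩`.
  rw [inner_shapeOperator_comm hx hN]
  have h2 := congr($h v)
  rw [LinearMap.comp_apply] at h2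
  rw [h2, LinearMap.smul_apply, LinearMap.id_apply, real_inner_smul_left]

end

end LorentzianMetric

end

theorem mainTheorem5
    {M : Type*} [TopologicalSpace M] [T2Space M] [SecondCountableTopology M]
    [ChartedSpace (Coord 3) M] [IsManifold (𝓡 3) ∞ M]
    (g : LorentzianMetric 3 M)
    (ξ : (q : M) → TangentSpace (𝓡 3) q) (hξ : g.IsParallelLightlike ξ)
    (hTCC : g.TimelikeConvergence)
    {S : Type*} [MetricSpace S] [ConnectedSpace S]
    [ChartedSpace (Coord 2) S] [IsManifold (𝓡 2) ∞ S]
    [RiemannianBundle (fun p : S ↦ TangentSpace (𝓡 2) p)]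
    [IsContMDiffRiemannianBundle (𝓡 2) ∞ (Coord 2) (fun p : S ↦ TangentSpace (𝓡 2) p)]
    [IsRiemannianManifold (𝓡 2) S] [CompleteSpace S]
    (x : S → M) (hx : g.IsIsometricImmersion (m := 2) x) (hmax : g.IsMaximal (m := 2) x) :
    (∃! N : (p : S) → TangentSpace (𝓡 3) (x p),
      g.IsUnitNormal (m := 2) x N ∧ ∀ p, 0 < g.form (x p) (N p) (ξ (x p))) ∧
    ∀ N : (p : S) → TangentSpace (𝓡 3) (x p), g.IsUnitNormal (m := 2) x N →
      ∀ η : S → ℝ, (∀ p, η p = g.form (x p) (N p) (ξ (x p))) → (∀ p, 0 < η p) →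
        (∀ p, ‖LorentzianMetric.gradient (m := 2) η p‖ ^ 2 =
          1 / 2 * LinearMap.trace ℝ (TangentSpace (𝓡 2) p)
            (g.shapeOperator (m := 2) x N p ∘ₗ g.shapeOperator (m := 2) x N p) * η p ^ 2) ∧
        ((∃ c, ∀ p, η p = c) ↔ g.IsTotallyGeodesic (m := 2) x) := by
  refine ⟨LorentzianMetric.existsUnique_unitNormal hx rfl hξ, ?_⟩
  intro N hN η hη hηpos
  obtain rfl : η = fun p ↦ g.form (x p) (N p) (ξ (x p)) := funext hη
  have hgrad : ∀ p, ‖LorentzianMetric.gradient (m := 2)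
      (fun p ↦ g.form (x p) (N p) (ξ (x p))) p‖ ^ 2 =
      1 / 2 * LinearMap.trace ℝ (TangentSpace (𝓡 2) p)
        (g.shapeOperator (m := 2) x N p ∘ₗ g.shapeOperator (m := 2) x N p) *
          g.form (x p) (N p) (ξ (x p)) ^ 2 := fun p ↦ by
    rw [← real_inner_self_eq_norm_sq, LorentzianMetric.gradient_form_normal hx hN rfl hξ,
      inner_neg_neg, LorentzianMetric.inner_shapeOperator_shapeOperator rfl hx hN hmax,
      LorentzianMetric.inner_tangentPart_self hx hN rfl hξ]
  refine ⟨hgrad, ?_⟩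
  rw [LorentzianMetric.isTotallyGeodesic_iff hx hN rfl]
  constructor
  · rintro ⟨c, hc⟩ p
    have h0 : LorentzianMetric.gradient (m := 2)
        (fun p ↦ g.form (x p) (N p) (ξ (x p))) p = 0 := by
      rw [LorentzianMetric.gradient_eq_zero_iff_mfderiv_eq_zero, funext hc, mfderiv_const]
      rfl
    have h1 := hgrad p
    rw [h0, norm_zero, zero_pow two_ne_zero] at h1
    have h2 := (mul_eq_zero.1 h1.symm).resolve_right (pow_pos (hηpos p) 2).ne'
    ext1 v
    -- Since `η ≠ 0`, `trace(A²) = 0`; self-adjointness upgrades this to `|A v|² = 0`.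
    have h3 := LorentzianMetric.inner_shapeOperator_shapeOperator rfl hx hN hmax p v
    rw [h2, zero_mul, inner_self_eq_zero] at h3
    exact h3
  · intro hA
    have hd : MDifferentiable (𝓡 2) 𝓘(ℝ, ℝ) (fun p ↦ g.form (x p) (N p) (ξ (x p))) := fun p ↦
      (g.contMDiffAt_form (Z := fun p ↦ ξ (x p)) (hN.contMDiff p)
        ((hξ.contMDiff.comp hx.contMDiff) p)).mdifferentiableAt (by simp)
    have hlc := isLocallyConstant_of_mfderiv_eq_zero hd fun p ↦ by
      rw [← LorentzianMetric.gradient_eq_zero_iff_mfderiv_eq_zero,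
        LorentzianMetric.gradient_form_normal hx hN rfl hξ, hA, LinearMap.zero_apply, neg_zero]
    exact ⟨_, fun p ↦ hlc.apply_eq_of_preconnectedSpace p (Classical.arbitrary S)⟩
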